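/- Let $d\ge 2$, $\eta>0$, and let $u_1^{(1)},\dots,u_n^{(1)}\in S^{d-1}$ be given unit vectors in $\mathbb{R}^d$ (the initial opinions of $n$ agents). Let $v^{(1)},v^{(2)},\dots$ be independent random vectors, each uniformly distributed on the unit sphere $S^{d-1}$ (the interventions), and for $t\ge 1$ and $1\le i\le n$ let $$u_i^{(t+1)}=\frac{w_i^{(t+1)}}{\|w_i^{(t+1)}\|},\qquad w_i^{(t+1)}=u_i^{(t)}+\eta\,\langle u_i^{(t)},v^{(t)}\rangle\, v^{(t)},$$ where $\|\cdot\|$ is the Euclidean norm. Then almost surely there exists $J\subseteq\{1,\dots,n\}$ such that the diameter of the set $$\left\{(-1)^{\mathbf 1[i\in J]}\,u_i^{(t)} : i\in\{1,\dots,n\}\right\}$$ converges to $0$ as $t\to\infty$. In other words, for this $J$ there are unit vectors $p^{(t)}\in S^{d-1}$ such that $\|u_i^{(t)}-(-1)^{\mathbf 1[i\in J]}p^{(t)}\|\to 0$ as $t\to\infty$ for every $i$: the opinions split into two clusters converging to the moving pair of antipodal points $\pm p^{(t)}$. -/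

import Mathlib

open MeasureTheory ProbabilityTheory Filter Topology

noncomputable section

/-- The unit sphere `S^{d-1}` of `ℝ^d` with the Euclidean norm. -/
abbrev UnitSphere (d : ℕ) : Type :=
  Metric.sphere (0 : EuclideanSpace ℝ (Fin d)) 1

/-- The uniform distribution on the unit sphere: the surface measure induced by Lebesgue measure,
normalized to total mass `1`. -/
def uniformSphere (d : ℕ) : Measure (UnitSphere d) :=
  ((volume : Measure (EuclideanSpace ℝ (Fin d))).toSphere Set.univ)⁻¹ •
    (volume : Measure (EuclideanSpace ℝ (Fin d))).toSphere

/-- The opinion `u` after the intervention `v`, before normalization: `w = u + η ⟨u, v⟩ v`. -/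
def rawUpdate {d : ℕ} (η : ℝ) (u v : EuclideanSpace ℝ (Fin d)) : EuclideanSpace ℝ (Fin d) :=
  u + (η * inner ℝ u v) • v

/-- The updated opinion `w / ‖w‖`. -/
def updateOpinion {d : ℕ} (η : ℝ) (u v : EuclideanSpace ℝ (Fin d)) : EuclideanSpace ℝ (Fin d) :=
  ‖rawUpdate η u v‖⁻¹ • rawUpdate η u v

/-- The opinion of an agent with initial opinion `u₀` after the first `t` interventions
`v 0, …, v (t - 1)`. -/
def opinion {d : ℕ} (η : ℝ) (v : ℕ → UnitSphere d) (u₀ : UnitSphere d) :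
    ℕ → EuclideanSpace ℝ (Fin d)
  | 0 => u₀
  | t + 1 => updateOpinion η (opinion η v u₀ t) (v t)

/-- The sign `(-1)^{1[i ∈ J]}`. -/
def flipSign {n : ℕ} (J : Finset (Fin n)) (i : Fin n) : ℝ :=
  (-1) ^ (if i ∈ J then 1 else 0)

end

/-! Fix two agents and follow `sqSine`, the squared sine of their angle. With κ = 2η + η², one
intervention v multiplies it by (1 + κ|πv|²) / ((1 + κ⟨x,v⟩²)(1 + κ⟨y,v⟩²)), where π is the
projection onto the plane of x and y (`sqSine_updateOpinion_eq_exp`). The logarithm splits into two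
terms, each a function of the coordinates of v along an orthonormal pair, so by rotation invariance
its mean is a constant -2l whatever the angle; exchanging the two coordinates shows l > 0
(`exists_integral_logRate_eq_neg`).

A drift bounded away from 0 and bounded increments make a small power δ of `sqSine` contract in mean
(`exists_lintegral_sqSine_rpow_le`). Its expectations are then summable, so `sqSine` tends to 0
almost surely (`ae_tendsto_sqSine_opinion`).

What remains is deterministic: an angle close to 0 cannot jump close to π in one step, so each pair
either merges or becomes antipodal (`tendsto_norm_sub_or_add_opinion`). Comparing every agent with
one reference agent gives J and p. -/

/-! ### Rotation invariance of the uniform measure -/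

/-- The action of a linear isometry equivalence on the unit sphere. -/
noncomputable def sphereMap {d : ℕ} (L : EuclideanSpace ℝ (Fin d) ≃ₗᵢ[ℝ] EuclideanSpace ℝ (Fin d))
    (v : UnitSphere d) : UnitSphere d :=
  ⟨L v, by simp⟩

lemma continuous_sphereMap {d : ℕ}
    (L : EuclideanSpace ℝ (Fin d) ≃ₗᵢ[ℝ] EuclideanSpace ℝ (Fin d)) : Continuous (sphereMap L) :=
  (L.continuous.comp continuous_subtype_val).subtype_mk _

-- The surface measure of s is a multiple of the Lebesgue measure of the cone over s, and a linear
-- isometry maps cones to cones and preserves volume.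
open scoped Pointwise in
lemma map_sphereMap_toSphere {d : ℕ}
    (L : EuclideanSpace ℝ (Fin d) ≃ₗᵢ[ℝ] EuclideanSpace ℝ (Fin d)) :
    ((volume : Measure (EuclideanSpace ℝ (Fin d))).toSphere).map (sphereMap L) =
      (volume : Measure (EuclideanSpace ℝ (Fin d))).toSphere := by
  ext s hs
  have hm := (continuous_sphereMap L).measurable
  rw [Measure.map_apply hm hs, Measure.toSphere_apply' _ (hm hs), Measure.toSphere_apply' _ hs]
  congr 1
  rw [← (L.measurePreserving).measure_preimage_emb L.toMeasurableEquiv.measurableEmbedding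
    (Set.Ioo (0 : ℝ) 1 • (Subtype.val '' s))]
  congr 1
  ext x
  simp only [Set.mem_smul, Set.mem_image, Set.mem_preimage]
  constructor
  · rintro ⟨r, hr, _, ⟨y, hy, rfl⟩, rfl⟩
    exact ⟨r, hr, _, ⟨sphereMap L y, hy, rfl⟩, by simp [sphereMap]⟩
  · rintro ⟨r, hr, _, ⟨y, hy, rfl⟩, h⟩
    refine ⟨r, hr, _, ⟨sphereMap L.symm y, ?_, rfl⟩, ?_⟩
    · simpa [sphereMap] using hy
    · apply L.injective
      simpa [sphereMap] using h

lemma map_sphereMap_uniformSphere {d : ℕ}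
    (L : EuclideanSpace ℝ (Fin d) ≃ₗᵢ[ℝ] EuclideanSpace ℝ (Fin d)) :
    (uniformSphere d).map (sphereMap L) = uniformSphere d := by
  rw [uniformSphere, Measure.map_smul, map_sphereMap_toSphere]

lemma isProbabilityMeasure_uniformSphere {d : ℕ} (hd : 2 ≤ d) :
    IsProbabilityMeasure (uniformSphere d) := by
  have : Nonempty (Fin d) := ⟨⟨0, by omega⟩⟩
  constructor
  rw [uniformSphere, Measure.smul_apply, smul_eq_mul]
  refine ENNReal.inv_mul_cancel ?_ (measure_ne_top _ _)
  rw [Measure.measure_univ_ne_zero]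
  exact Measure.toSphere_ne_zero _

lemma isOpenPosMeasure_uniformSphere (d : ℕ) : (uniformSphere d).IsOpenPosMeasure := by
  constructor
  intro U hU hne
  rw [uniformSphere, Measure.smul_apply, smul_eq_mul]
  exact mul_ne_zero (ENNReal.inv_ne_zero.2 (measure_ne_top _ _)) (hU.measure_ne_zero _ hne)

/-- The joint law of the coordinates of a uniform vector along an orthonormal pair does not depend
on the pair. -/
lemma integral_uniformSphere_orthonormal_pair {d : ℕ} {i j : Fin d} (hij : i ≠ j)
    {e e' : EuclideanSpace ℝ (Fin d)} (he : ‖e‖ = 1) (he' : ‖e'‖ = 1) (h : inner ℝ e e' = 0)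
    {f : ℝ → ℝ → ℝ} (hf : Continuous fun p : ℝ × ℝ => f p.1 p.2) :
    ∫ v, f (inner ℝ e (v : EuclideanSpace ℝ (Fin d))) (inner ℝ e' (v : EuclideanSpace ℝ (Fin d)))
        ∂uniformSphere d =
      ∫ v, f ((v : EuclideanSpace ℝ (Fin d)) i) ((v : EuclideanSpace ℝ (Fin d)) j)
        ∂uniformSphere d := by
  classical
  have hon : Orthonormal ℝ (({i, j} : Set (Fin d)).domRestrict fun k => if k = i then e else e') := by
    constructor
    · rintro ⟨k, rfl | rfl⟩
      · simp [he]
      · simp [hij.symm, he']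
    · have h' : inner ℝ e' e = 0 := by rw [real_inner_comm, h]
      rintro ⟨k, rfl | rfl⟩ ⟨l, rfl | rfl⟩ hkl
      · simp at hkl
      · simp [hij.symm, h]
      · simp [hij.symm, h']
      · simp at hkl
  obtain ⟨b, hb⟩ := hon.exists_orthonormalBasis_extension_of_card_eq (by simp)
  have hbi : b i = e := by simpa using hb i (by simp)
  have hbj : b j = e' := by simpa [hij.symm] using hb j (by simp)
  -- The rotation `b.repr` turns the coordinates i and j into the inner products with e and e'.
  conv_rhs => rw [← map_sphereMap_uniformSphere b.repr]
  rw [integral_map (continuous_sphereMap _).aemeasurable]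
  · simp [sphereMap, b.repr_apply_apply, hbi, hbj]
  · refine Continuous.aestronglyMeasurable ?_
    exact hf.comp (f := fun v : UnitSphere d =>
      ((v : EuclideanSpace ℝ (Fin d)) i, (v : EuclideanSpace ℝ (Fin d)) j)) (by fun_prop)

/-! ### Effect of one intervention on the angle -/

/-- The squared sine of the angle between two unit vectors. -/
noncomputable def sqSine {d : ℕ} (x y : EuclideanSpace ℝ (Fin d)) : ℝ :=
  1 - (inner ℝ x y) ^ 2

section Geometry

variable {d : ℕ} {η : ℝ} {x y v : EuclideanSpace ℝ (Fin d)}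

lemma sqSine_nonneg (hx : ‖x‖ = 1) (hy : ‖y‖ = 1) : 0 ≤ sqSine x y := by
  have := abs_real_inner_le_norm x y
  rw [hx, hy, mul_one, abs_le] at this
  unfold sqSine
  nlinarith

lemma sqSine_le_one : sqSine x y ≤ 1 := by
  unfold sqSine
  nlinarith [sq_nonneg (inner ℝ x y)]

lemma inner_rawUpdate (hv : ‖v‖ = 1) :
    inner ℝ (rawUpdate η x v) (rawUpdate η y v) =
      inner ℝ x y + (2 * η + η ^ 2) * (inner ℝ x v * inner ℝ y v) := by
  simp only [rawUpdate, inner_add_left, inner_add_right, real_inner_smul_left,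
    real_inner_smul_right, real_inner_self_eq_norm_sq, hv, real_inner_comm v]
  ring

lemma sq_norm_rawUpdate (hx : ‖x‖ = 1) (hv : ‖v‖ = 1) :
    ‖rawUpdate η x v‖ ^ 2 = 1 + (2 * η + η ^ 2) * (inner ℝ x v) ^ 2 := by
  rw [← real_inner_self_eq_norm_sq, inner_rawUpdate hv, real_inner_self_eq_norm_sq, hx]
  ring

lemma norm_rawUpdate_pos (hη : 0 < η) (hx : ‖x‖ = 1) (hv : ‖v‖ = 1) :
    0 < ‖rawUpdate η x v‖ := by
  have := sq_norm_rawUpdate (η := η) hx hv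
  have h : 0 < ‖rawUpdate η x v‖ ^ 2 := by rw [this]; positivity
  exact (norm_nonneg _).lt_of_ne fun h0 => by simp [← h0] at h

lemma norm_updateOpinion (hη : 0 < η) (hx : ‖x‖ = 1) (hv : ‖v‖ = 1) :
    ‖updateOpinion η x v‖ = 1 := by
  rw [updateOpinion, norm_smul, norm_inv, norm_norm,
    inv_mul_cancel₀ (norm_rawUpdate_pos hη hx hv).ne']

lemma inner_updateOpinion (hv : ‖v‖ = 1) :
    inner ℝ (updateOpinion η x v) (updateOpinion η y v) =
      (‖rawUpdate η x v‖ * ‖rawUpdate η y v‖)⁻¹ *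
        (inner ℝ x y + (2 * η + η ^ 2) * (inner ℝ x v * inner ℝ y v)) := by
  rw [updateOpinion, updateOpinion, real_inner_smul_left, real_inner_smul_right,
    inner_rawUpdate hv, mul_inv]
  ring

/-- The numerator is the Gram determinant of the two raw updates; its κ² terms cancel. -/
lemma sqSine_updateOpinion (hη : 0 < η) (hx : ‖x‖ = 1) (hy : ‖y‖ = 1) (hv : ‖v‖ = 1) :
    sqSine (updateOpinion η x v) (updateOpinion η y v) =
      (sqSine x y + (2 * η + η ^ 2) * ((inner ℝ x v) ^ 2 + (inner ℝ y v) ^ 2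
        - 2 * inner ℝ x v * inner ℝ y v * inner ℝ x y)) /
      ((1 + (2 * η + η ^ 2) * (inner ℝ x v) ^ 2) * (1 + (2 * η + η ^ 2) * (inner ℝ y v) ^ 2)) := by
  have h1 := norm_rawUpdate_pos hη hx hv
  have h2 := norm_rawUpdate_pos hη hy hv
  rw [sqSine, inner_updateOpinion hv, mul_pow, inv_pow, mul_pow, sq_norm_rawUpdate hx hv,
    sq_norm_rawUpdate hy hv, sqSine]
  have h3 : 0 < 1 + (2 * η + η ^ 2) * (inner ℝ x v) ^ 2 := by positivity
  have h4 : 0 < 1 + (2 * η + η ^ 2) * (inner ℝ y v) ^ 2 := by positivity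
  field_simp
  ring

/-- The logarithmic rate `log (1 + κ (p² + q²)) / 2 - log (1 + κ p²)`. -/
noncomputable def logRate (κ p q : ℝ) : ℝ :=
  Real.log (1 + κ * (p ^ 2 + q ^ 2)) / 2 - Real.log (1 + κ * p ^ 2)

lemma continuous_logRate {κ : ℝ} (hκ : 0 < κ) :
    Continuous fun z : ℝ × ℝ => logRate κ z.1 z.2 := by
  unfold logRate
  refine Continuous.sub (Continuous.div_const (Continuous.log (by fun_prop) ?_) _)
    (Continuous.log (by fun_prop) ?_)
  · intro z; positivity
  · intro z; positivity

lemma abs_logRate_le {κ p q : ℝ} (hκ : 0 < κ) (hp : |p| ≤ 1) (hq : |q| ≤ 1) :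
    |logRate κ p q| ≤ Real.log (1 + 2 * κ) := by
  have hp2 : p ^ 2 ≤ 1 := (sq_le_one_iff_abs_le_one p).2 hp
  have hq2 : q ^ 2 ≤ 1 := (sq_le_one_iff_abs_le_one q).2 hq
  have h1 : 0 ≤ Real.log (1 + κ * (p ^ 2 + q ^ 2)) := Real.log_nonneg (by
    have : 0 ≤ κ * (p ^ 2 + q ^ 2) := by positivity
    linarith)
  have h2 : 0 ≤ Real.log (1 + κ * p ^ 2) := Real.log_nonneg (by
    have : 0 ≤ κ * p ^ 2 := by positivity
    linarith)
  have h3 : Real.log (1 + κ * (p ^ 2 + q ^ 2)) ≤ Real.log (1 + 2 * κ) :=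
    Real.log_le_log (by positivity) (by nlinarith)
  have h4 : Real.log (1 + κ * p ^ 2) ≤ Real.log (1 + 2 * κ) :=
    Real.log_le_log (by positivity) (by nlinarith)
  unfold logRate
  rw [abs_le]
  constructor <;> linarith

/-- The product (1 + κp²)(1 + κq²) exceeds 1 + κ(p² + q²) by κ²p²q². -/
lemma logRate_add_swap_nonpos {κ : ℝ} (hκ : 0 < κ) (p q : ℝ) :
    logRate κ p q + logRate κ q p ≤ 0 := by
  have h : Real.log (1 + κ * (p ^ 2 + q ^ 2)) ≤
      Real.log (1 + κ * p ^ 2) + Real.log (1 + κ * q ^ 2) := by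
    rw [← Real.log_mul (by positivity) (by positivity)]
    refine Real.log_le_log (by positivity) ?_
    have : 0 ≤ (κ * p ^ 2) * (κ * q ^ 2) := by positivity
    linarith
  unfold logRate
  rw [add_comm (q ^ 2)]
  linarith

lemma logRate_add_swap_neg {κ p q : ℝ} (hκ : 0 < κ) (hp : p ≠ 0) (hq : q ≠ 0) :
    logRate κ p q + logRate κ q p < 0 := by
  have h : Real.log (1 + κ * (p ^ 2 + q ^ 2)) <
      Real.log (1 + κ * p ^ 2) + Real.log (1 + κ * q ^ 2) := by
    rw [← Real.log_mul (by positivity) (by positivity)]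
    refine Real.log_lt_log (by positivity) ?_
    have : 0 < (κ * p ^ 2) * (κ * q ^ 2) := by positivity
    linarith
  unfold logRate
  rw [add_comm (q ^ 2)]
  linarith

/-- The Gram–Schmidt complement of `x` in the plane of `x` and `y`. -/
noncomputable def planeNormal (x y : EuclideanSpace ℝ (Fin d)) : EuclideanSpace ℝ (Fin d) :=
  (Real.sqrt (sqSine x y))⁻¹ • (y - inner ℝ x y • x)

lemma inner_planeNormal (hx : ‖x‖ = 1) : inner ℝ x (planeNormal x y) = 0 := by
  simp [planeNormal, inner_smul_right, inner_sub_right, hx]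

lemma norm_planeNormal (hx : ‖x‖ = 1) (hy : ‖y‖ = 1) (h : 0 < sqSine x y) :
    ‖planeNormal x y‖ = 1 := by
  have h1 : ‖y - inner ℝ x y • x‖ ^ 2 = sqSine x y := by
    rw [norm_sub_sq_real, norm_smul, hx, hy, real_inner_smul_right, real_inner_comm x y, sqSine,
      Real.norm_eq_abs, mul_one, sq_abs]
    ring
  rw [planeNormal, norm_smul, norm_inv, Real.norm_of_nonneg (Real.sqrt_nonneg _), ← h1,
    Real.sqrt_sq (norm_nonneg _)]
  refine inv_mul_cancel₀ fun h0 => ?_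
  rw [h0] at h1
  norm_num at h1
  exact h.ne h1

/-- Both sides are the squared length of the projection of v onto the plane of x and y; the right
one is symmetric in x and y. -/
lemma inner_planeNormal_sq (h : 0 < sqSine x y) :
    (inner ℝ x v) ^ 2 + (inner ℝ (planeNormal x y) v) ^ 2 =
      ((inner ℝ x v) ^ 2 + (inner ℝ y v) ^ 2
        - 2 * inner ℝ x v * inner ℝ y v * inner ℝ x y) / sqSine x y := by
  rw [planeNormal, real_inner_smul_left, inner_sub_left, real_inner_smul_left, mul_pow, inv_pow,
    Real.sq_sqrt h.le]
  field_simp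
  rw [sqSine]
  ring

lemma sqSine_comm : sqSine x y = sqSine y x := by
  rw [sqSine, real_inner_comm, sqSine]

lemma sqSine_updateOpinion_eq_exp (hη : 0 < η) (hx : ‖x‖ = 1) (hy : ‖y‖ = 1) (hv : ‖v‖ = 1)
    (h : 0 < sqSine x y) :
    sqSine (updateOpinion η x v) (updateOpinion η y v) = sqSine x y *
      Real.exp (logRate (2 * η + η ^ 2) (inner ℝ x v) (inner ℝ (planeNormal x y) v) +
        logRate (2 * η + η ^ 2) (inner ℝ y v) (inner ℝ (planeNormal y x) v)) := by
  have h' : 0 < sqSine y x := sqSine_comm (x := x) ▸ h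
  have e1 := inner_planeNormal_sq (v := v) h
  have e2 : (inner ℝ y v) ^ 2 + (inner ℝ (planeNormal y x) v) ^ 2 =
      (inner ℝ x v) ^ 2 + (inner ℝ (planeNormal x y) v) ^ 2 := by
    rw [e1, inner_planeNormal_sq h', sqSine_comm (x := y), real_inner_comm x y]
    ring
  have h3 : 0 < 1 + (2 * η + η ^ 2) * (inner ℝ x v) ^ 2 := by positivity
  have h4 : 0 < 1 + (2 * η + η ^ 2) * (inner ℝ y v) ^ 2 := by positivity
  have h5 : 0 < 1 + (2 * η + η ^ 2) *
      ((inner ℝ x v) ^ 2 + (inner ℝ (planeNormal x y) v) ^ 2) := by positivity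
  rw [logRate, logRate, e2]
  have e3 : ∀ A B C : ℝ, A / 2 - B + (A / 2 - C) = A - B - C := by intros; ring
  rw [e3, Real.exp_sub, Real.exp_sub, Real.exp_log h3, Real.exp_log h4, Real.exp_log h5, e1,
    sqSine_updateOpinion hη hx hy hv]
  field_simp

lemma sqSine_updateOpinion_eq_zero (hη : 0 < η) (hx : ‖x‖ = 1) (hy : ‖y‖ = 1) (hv : ‖v‖ = 1)
    (h : sqSine x y = 0) : sqSine (updateOpinion η x v) (updateOpinion η y v) = 0 := by
  have h1 : inner ℝ x y = 1 ∨ inner ℝ x y = -1 := by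
    rw [sqSine] at h
    exact sq_eq_sq_iff_eq_or_eq_neg.1 (by linarith)
  have key : inner ℝ x v ^ 2 + inner ℝ y v ^ 2 -
      2 * inner ℝ x v * inner ℝ y v * inner ℝ x y = 0 := by
    rcases h1 with h1 | h1
    · rw [(inner_eq_one_iff_of_norm_eq_one hx hy).1 h1, real_inner_self_eq_norm_sq, hy]; ring
    · have : x = -y := (inner_eq_neg_one_iff_of_norm_eq_one hx hy).1 h1
      rw [this, inner_neg_left, inner_neg_left, real_inner_self_eq_norm_sq, hy]; ring
  rw [sqSine_updateOpinion hη hx hy hv, key, h]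
  simp

/-- A nearly aligned pair stays in the same half space. -/
lemma inner_updateOpinion_pos (hη : 0 < η) (hx : ‖x‖ = 1) (hy : ‖y‖ = 1) (hv : ‖v‖ = 1)
    (h : (2 * η + η ^ 2) * (1 - inner ℝ x y) < inner ℝ x y) :
    0 < inner ℝ (updateOpinion η x v) (updateOpinion η y v) := by
  have h1 := norm_rawUpdate_pos hη hx hv
  have h2 := norm_rawUpdate_pos hη hy hv
  rw [inner_updateOpinion hv]
  refine mul_pos (by positivity) ?_
  have h3 : (inner ℝ x v - inner ℝ y v) ^ 2 ≤ 2 - 2 * inner ℝ x y := by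
    have h4 := abs_real_inner_le_norm (x - y) v
    rw [inner_sub_left, hv, mul_one] at h4
    have h5 : ‖x - y‖ ^ 2 = 2 - 2 * inner ℝ x y := by
      rw [norm_sub_sq_real, hx, hy]; ring
    rw [← h5, ← sq_abs]
    exact pow_le_pow_left₀ (abs_nonneg _) h4 2
  have h6 : -(1 - inner ℝ x y) ≤ inner ℝ x v * inner ℝ y v := by
    nlinarith [sq_nonneg (inner ℝ x v + inner ℝ y v), sq_nonneg (inner ℝ x v),
      sq_nonneg (inner ℝ y v)]
  have h7 : 0 < 2 * η + η ^ 2 := by positivity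
  nlinarith

lemma updateOpinion_neg : updateOpinion η (-x) v = -updateOpinion η x v := by
  have : rawUpdate η (-x) v = -rawUpdate η x v := by
    simp [rawUpdate, add_comm]
  rw [updateOpinion, this, norm_neg, smul_neg, updateOpinion]

end Geometry

/-! ### Negative drift and contraction in expectation -/

lemma abs_inner_sphere_le_one {d : ℕ} {e : EuclideanSpace ℝ (Fin d)} (he : ‖e‖ = 1)
    (v : UnitSphere d) : |inner ℝ e (v : EuclideanSpace ℝ (Fin d))| ≤ 1 := by
  simpa [he] using abs_real_inner_le_norm e (v : EuclideanSpace ℝ (Fin d))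

lemma integrable_of_continuous_uniformSphere {d : ℕ} (hd : 2 ≤ d) {f : UnitSphere d → ℝ}
    (hf : Continuous f) : Integrable f (uniformSphere d) := by
  have := isProbabilityMeasure_uniformSphere hd
  have : CompactSpace (UnitSphere d) := isCompact_iff_compactSpace.1 (isCompact_sphere _ _)
  exact hf.integrable_of_hasCompactSupport (HasCompactSupport.of_compactSpace f)

/-- `logRate` itself takes both signs. Only its sum with the swapped version is nonpositive, and the
two have equal integrals by invariance. -/
lemma exists_integral_logRate_eq_neg {d : ℕ} (hd : 2 ≤ d) {κ : ℝ} (hκ : 0 < κ) :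
    ∃ l : ℝ, 0 < l ∧ ∀ e e' : EuclideanSpace ℝ (Fin d), ‖e‖ = 1 → ‖e'‖ = 1 → inner ℝ e e' = 0 →
      ∫ v, logRate κ (inner ℝ e (v : EuclideanSpace ℝ (Fin d)))
        (inner ℝ e' (v : EuclideanSpace ℝ (Fin d))) ∂uniformSphere d = -l := by
  have := isProbabilityMeasure_uniformSphere hd
  have := isOpenPosMeasure_uniformSphere d
  set i : Fin d := ⟨0, by omega⟩
  set j : Fin d := ⟨1, by omega⟩
  have hij : i ≠ j := by simp [i, j]
  set E := EuclideanSpace ℝ (Fin d)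
  have hc : ∀ k l : Fin d, Continuous fun v : UnitSphere d => logRate κ ((v : E) k) ((v : E) l) :=
    fun k l => (continuous_logRate hκ).comp (f := fun v : UnitSphere d => ((v : E) k, (v : E) l))
      (by fun_prop)
  have hi := fun k l => integrable_of_continuous_uniformSphere hd (hc k l)
  have hs : ∀ (k : Fin d) (w : E), inner ℝ (EuclideanSpace.single k (1 : ℝ)) w = w k :=
    fun k w => by rw [EuclideanSpace.inner_single_left]; simp
  have hswap : ∫ v, logRate κ ((v : E) j) ((v : E) i) ∂uniformSphere d =
      ∫ v, logRate κ ((v : E) i) ((v : E) j) ∂uniformSphere d := by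
    have h := integral_uniformSphere_orthonormal_pair hij
      (e := EuclideanSpace.single j (1 : ℝ)) (e' := EuclideanSpace.single i (1 : ℝ))
      (by simp) (by simp) (by rw [hs]; simp [hij]) (continuous_logRate hκ)
    simpa only [hs] using h
  have hneg : 0 < ∫ v, -(logRate κ ((v : E) i) ((v : E) j) + logRate κ ((v : E) j) ((v : E) i))
      ∂uniformSphere d := by
    have hw : ‖EuclideanSpace.single i (1 : ℝ) + EuclideanSpace.single j (1 : ℝ)‖ ≠ 0 := by
      intro h0
      have := congrArg (fun z : E => z i) (norm_eq_zero.1 h0)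
      simp [hij] at this
    -- A point with both coordinates nonzero: there the integrand is strictly positive, which
    -- suffices by continuity since open sets have positive measure.
    let w : UnitSphere d :=
      ⟨‖EuclideanSpace.single i (1 : ℝ) + EuclideanSpace.single j (1 : ℝ)‖⁻¹ •
        (EuclideanSpace.single i (1 : ℝ) + EuclideanSpace.single j (1 : ℝ)), by
          rw [mem_sphere_zero_iff_norm, norm_smul, norm_inv, norm_norm, inv_mul_cancel₀ hw]⟩
    refine ((hc i j).add (hc j i)).neg.integral_pos_of_hasCompactSupport_nonneg_nonzero ?_
      (fun v => neg_nonneg.2 (logRate_add_swap_nonpos hκ _ _)) (x := w) ?_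
    · have : CompactSpace (UnitSphere d) := isCompact_iff_compactSpace.1 (isCompact_sphere _ _)
      exact HasCompactSupport.of_compactSpace _
    · refine (neg_pos.2 (logRate_add_swap_neg hκ ?_ ?_)).ne'
      · simpa [w, hij] using hw
      · simpa [w, hij.symm] using hw
  rw [integral_neg, integral_add (hi i j) (hi j i), hswap] at hneg
  refine ⟨-∫ v, logRate κ ((v : E) i) ((v : E) j) ∂uniformSphere d, by linarith,
    fun e e' he he' h => ?_⟩
  rw [integral_uniformSphere_orthonormal_pair hij he he' h (continuous_logRate hκ), neg_neg]

/-- A fractional power of the squared sine of the angle contracts in expectation, at a rate that is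
uniform in the pair of opinions. -/
lemma exists_lintegral_sqSine_rpow_le {d : ℕ} (hd : 2 ≤ d) {η : ℝ} (hη : 0 < η) :
    ∃ δ : ℝ, 0 < δ ∧ ∃ ρ : ENNReal, ρ < 1 ∧ ∀ x y : UnitSphere d,
      ∫⁻ v, ENNReal.ofReal (sqSine (updateOpinion η (x : EuclideanSpace ℝ (Fin d))
          (v : EuclideanSpace ℝ (Fin d))) (updateOpinion η y v) ^ δ) ∂uniformSphere d ≤
        ρ * ENNReal.ofReal (sqSine (x : EuclideanSpace ℝ (Fin d)) y ^ δ) := by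
  have := isProbabilityMeasure_uniformSphere hd
  set κ := 2 * η + η ^ 2 with hκdef
  have hκ : 0 < κ := by positivity
  obtain ⟨l, hl, hint⟩ := exists_integral_logRate_eq_neg hd hκ
  set M := Real.log (1 + 2 * κ)
  have hM : 0 < M := Real.log_pos (by linarith)
  -- The first bound keeps the exponent in [-1, 1], where exp z ≤ 1 + z + z². The second gives
  -- (2Mδ)² ≤ lδ, so the quadratic error costs at most half of the gain 2lδ.
  set δ := min (1 / (2 * M)) (l / (4 * M ^ 2))
  have hδ : 0 < δ := lt_min (by positivity) (by positivity)
  have hδ1 : δ * (2 * M) ≤ 1 := by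
    rw [← le_div_iff₀ (by positivity)]; exact min_le_left _ _
  have hδ2 : δ * (4 * M ^ 2) ≤ l := by
    rw [← le_div_iff₀ (by positivity)]; exact min_le_right _ _
  refine ⟨δ, hδ, ENNReal.ofReal (1 - l * δ), ?_, fun x y => ?_⟩
  · rw [ENNReal.ofReal_lt_one]
    nlinarith
  set E := EuclideanSpace ℝ (Fin d)
  have hx : ‖(x : E)‖ = 1 := by simp
  have hy : ‖(y : E)‖ = 1 := by simp
  -- Parallel opinions span no plane, so they are treated apart: they stay parallel.
  rcases (sqSine_nonneg hx hy).eq_or_lt with h0 | h0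
  · refine le_of_eq_of_le ?_ zero_le
    refine (lintegral_congr fun v => ?_).trans lintegral_zero
    rw [sqSine_updateOpinion_eq_zero hη hx hy (by simp) h0.symm, Real.zero_rpow hδ.ne']
    simp
  have h0' : 0 < sqSine (y : E) x := sqSine_comm (x := (x : E)) ▸ h0
  set f : UnitSphere d → ℝ := fun v =>
    logRate κ (inner ℝ (x : E) (v : E)) (inner ℝ (planeNormal (x : E) y) (v : E))
  set g : UnitSphere d → ℝ := fun v =>
    logRate κ (inner ℝ (y : E) (v : E)) (inner ℝ (planeNormal (y : E) x) (v : E))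
  have hf : Continuous f := (continuous_logRate hκ).comp (f := fun v : UnitSphere d =>
    (inner ℝ (x : E) (v : E), inner ℝ (planeNormal (x : E) y) (v : E))) (by fun_prop)
  have hg : Continuous g := (continuous_logRate hκ).comp (f := fun v : UnitSphere d =>
    (inner ℝ (y : E) (v : E), inner ℝ (planeNormal (y : E) x) (v : E))) (by fun_prop)
  have hfi : ∫ v, f v ∂uniformSphere d = -l :=
    hint _ _ hx (norm_planeNormal hx hy h0) (inner_planeNormal hx)
  have hgi : ∫ v, g v ∂uniformSphere d = -l :=
    hint _ _ hy (norm_planeNormal hy hx h0') (inner_planeNormal hy)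
  have hfg : ∀ v, |f v + g v| ≤ 2 * M := fun v => by
    have h1 := abs_logRate_le hκ (abs_inner_sphere_le_one hx v)
      (abs_inner_sphere_le_one (norm_planeNormal hx hy h0) v)
    have h2 := abs_logRate_le hκ (abs_inner_sphere_le_one hy v)
      (abs_inner_sphere_le_one (norm_planeNormal hy hx h0') v)
    exact (abs_add_le _ _).trans (by linarith)
  have hexp : ∀ v, Real.exp ((f v + g v) * δ) ≤ 1 + (f v + g v) * δ + (2 * M * δ) ^ 2 := fun v => by
    have h1 : |(f v + g v) * δ| ≤ 2 * M * δ := by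
      rw [abs_mul, abs_of_pos hδ]
      exact mul_le_mul_of_nonneg_right (hfg v) hδ.le
    have h2 := (abs_le.1 (Real.abs_exp_sub_one_sub_id_le (h1.trans (by linarith)))).2
    have h3 := pow_le_pow_left₀ (abs_nonneg _) h1 2
    rw [sq_abs] at h3
    linarith
  have hce : Continuous fun v => Real.exp ((f v + g v) * δ) := by fun_prop
  have hie := integrable_of_continuous_uniformSphere hd hce
  have hbound : ∫ v, Real.exp ((f v + g v) * δ) ∂uniformSphere d ≤ 1 - l * δ := by
    have h1 : ∫ v, Real.exp ((f v + g v) * δ) ∂uniformSphere d ≤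
        ∫ v, (1 + (f v + g v) * δ + (2 * M * δ) ^ 2) ∂uniformSphere d :=
      integral_mono hie (integrable_of_continuous_uniformSphere hd (by fun_prop)) hexp
    have h2 : ∫ v, (1 + (f v + g v) * δ + (2 * M * δ) ^ 2) ∂uniformSphere d =
        1 + (-l + -l) * δ + (2 * M * δ) ^ 2 := by
      rw [integral_add (integrable_of_continuous_uniformSphere hd (by fun_prop))
        (integrable_const _), integral_add (integrable_const _)
        (integrable_of_continuous_uniformSphere hd (by fun_prop)), integral_mul_const,
        integral_add (integrable_of_continuous_uniformSphere hd hf)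
        (integrable_of_continuous_uniformSphere hd hg), hfi, hgi]
      simp
    nlinarith
  calc ∫⁻ v, ENNReal.ofReal (sqSine (updateOpinion η (x : E) (v : E))
          (updateOpinion η (y : E) (v : E)) ^ δ) ∂uniformSphere d
      = ∫⁻ v, ENNReal.ofReal (Real.exp ((f v + g v) * δ)) *
          ENNReal.ofReal (sqSine (x : E) y ^ δ) ∂uniformSphere d := by
        refine lintegral_congr fun v => ?_
        rw [sqSine_updateOpinion_eq_exp hη hx hy (by simp) h0,
          Real.mul_rpow h0.le (Real.exp_pos _).le, ← Real.exp_mul, mul_comm,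
          ENNReal.ofReal_mul (Real.exp_pos _).le]
    _ = ENNReal.ofReal (∫ v, Real.exp ((f v + g v) * δ) ∂uniformSphere d) *
          ENNReal.ofReal (sqSine (x : E) y ^ δ) := by
        rw [lintegral_mul_const _ (by fun_prop),
          ofReal_integral_eq_lintegral_ofReal hie (ae_of_all _ fun v => (Real.exp_pos _).le)]
    _ ≤ _ := by gcongr

/-! ### Measurability and dependence on the past -/

lemma norm_opinion {d : ℕ} {η : ℝ} (hη : 0 < η) (v : ℕ → UnitSphere d) (x : UnitSphere d) (t : ℕ) :
    ‖opinion η v x t‖ = 1 := by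
  induction t with
  | zero => simp [opinion]
  | succ t ih => exact norm_updateOpinion hη ih (by simp)

lemma opinion_congr {d : ℕ} {η : ℝ} {v w : ℕ → UnitSphere d} (x : UnitSphere d) {t : ℕ}
    (h : ∀ s < t, v s = w s) : opinion η v x t = opinion η w x t := by
  induction t with
  | zero => rfl
  | succ t ih =>
    rw [opinion, opinion, ih fun s hs => h s (hs.trans t.lt_succ_self), h t t.lt_succ_self]

lemma Measurable.updateOpinion {α : Type*} [MeasurableSpace α] {d : ℕ} (η : ℝ)
    {f g : α → EuclideanSpace ℝ (Fin d)} (hf : Measurable f) (hg : Measurable g) :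
    Measurable fun a => updateOpinion η (f a) (g a) := by
  unfold _root_.updateOpinion rawUpdate
  fun_prop

lemma measurable_opinion {d : ℕ} (η : ℝ) (x : UnitSphere d) (t : ℕ) :
    Measurable fun v : ℕ → UnitSphere d => opinion η v x t := by
  induction t with
  | zero => exact measurable_const
  | succ t ih =>
    simp only [opinion]
    exact ih.updateOpinion η (by fun_prop)

lemma Measurable.sqSine {α : Type*} [MeasurableSpace α] {d : ℕ}
    {f g : α → EuclideanSpace ℝ (Fin d)} (hf : Measurable f) (hg : Measurable g) :
    Measurable fun a => sqSine (f a) (g a) := by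
  unfold _root_.sqSine
  fun_prop

/-- The opinion as a point of the sphere. -/
noncomputable def sphereOpinion {d : ℕ} {η : ℝ} (hη : 0 < η) (x : UnitSphere d) (t : ℕ)
    (v : ℕ → UnitSphere d) : UnitSphere d :=
  ⟨opinion η v x t, by simpa using norm_opinion hη v x t⟩

lemma measurable_sphereOpinion {d : ℕ} {η : ℝ} (hη : 0 < η) (x : UnitSphere d) (t : ℕ) :
    Measurable (sphereOpinion hη x t) :=
  (measurable_opinion η x t).subtype_mk

/-! ### Almost sure alignment up to sign -/

section Probability

variable {Ω : Type*} [MeasurableSpace Ω] {P : Measure Ω}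
  {d : ℕ} {η : ℝ} {v : ℕ → Ω → UnitSphere d}

lemma indepFun_sphereOpinion (hη : 0 < η) (hv_indep : iIndepFun v P)
    (hv : ∀ t, AEMeasurable (v t) P) (x y : UnitSphere d) (t : ℕ) :
    IndepFun (fun ω => (sphereOpinion hη x t fun s => v s ω, sphereOpinion hη y t fun s => v s ω))
      (v t) P := by
  classical
  have h := hv_indep.indepFun_finset₀ (Finset.range t) {t} (by simp) hv
  -- Pads a history of length t; the default x is never seen by the opinions at time t.
  let ext : (Finset.range t → UnitSphere d) → ℕ → UnitSphere d := fun w s =>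
    if hs : s ∈ Finset.range t then w ⟨s, hs⟩ else x
  have hext : Measurable ext := by
    refine measurable_pi_iff.2 fun s => ?_
    by_cases hs : s ∈ Finset.range t
    · simp only [ext, dif_pos hs]
      fun_prop
    · simp only [ext, dif_neg hs]
      fun_prop
  have hφ : Measurable fun w => (sphereOpinion hη x t (ext w), sphereOpinion hη y t (ext w)) :=
    ((measurable_sphereOpinion hη x t).comp hext).prodMk
      ((measurable_sphereOpinion hη y t).comp hext)
  have hψ : Measurable fun w : ({t} : Finset ℕ) → UnitSphere d => w ⟨t, by simp⟩ := by fun_prop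
  refine (h.comp hφ hψ).congr (ae_of_all _ fun ω => ?_) (ae_of_all _ fun ω => rfl)
  have hs : ∀ s < t, ext (fun i => v i ω) s = v s ω := fun s hs => by simp [ext, hs]
  simp only [Function.comp, sphereOpinion]
  congr 2 <;> exact opinion_congr _ hs

lemma ae_tendsto_sqSine_opinion [IsProbabilityMeasure P] (hd : 2 ≤ d) (hη : 0 < η)
    (hv_indep : iIndepFun v P)
    (hv_unif : ∀ t, HasLaw (v t) (uniformSphere d) P) (x y : UnitSphere d) :
    ∀ᵐ ω ∂P, Tendsto (fun t => sqSine (opinion η (fun s => v s ω) x t)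
      (opinion η (fun s => v s ω) y t)) atTop (𝓝 0) := by
  have := isProbabilityMeasure_uniformSphere hd
  obtain ⟨δ, hδ, ρ, hρ, hcontr⟩ := exists_lintegral_sqSine_rpow_le hd hη
  set E := EuclideanSpace ℝ (Fin d)
  have hv : ∀ t, AEMeasurable (v t) P := fun t => (hv_unif t).aemeasurable
  have hvs : AEMeasurable (fun ω s => v s ω) P := aemeasurable_pi_lambda _ hv
  let F : ℕ → Ω → ENNReal := fun t ω => ENNReal.ofReal
    (sqSine (opinion η (fun s => v s ω) x t) (opinion η (fun s => v s ω) y t) ^ δ)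
  have hF : ∀ t, AEMeasurable (F t) P := fun t =>
    ((((measurable_opinion η x t).sqSine (measurable_opinion η y t)).pow_const
      δ).ennreal_ofReal).comp_aemeasurable hvs
  have hstep : ∀ t, ∫⁻ ω, F (t + 1) ω ∂P ≤ ρ * ∫⁻ ω, F t ω ∂P := by
    intro t
    let X : Ω → UnitSphere d × UnitSphere d := fun ω =>
      (sphereOpinion hη x t fun s => v s ω, sphereOpinion hη y t fun s => v s ω)
    have hX : AEMeasurable X P :=
      ((measurable_sphereOpinion hη x t).prodMk
        (measurable_sphereOpinion hη y t)).comp_aemeasurable hvs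
    let H : (UnitSphere d × UnitSphere d) × UnitSphere d → ENNReal := fun z => ENNReal.ofReal
      (sqSine (updateOpinion η (z.1.1 : E) (z.2 : E)) (updateOpinion η (z.1.2 : E) (z.2 : E)) ^ δ)
    have hH : Measurable H :=
      (((Measurable.updateOpinion η (by fun_prop) (by fun_prop)).sqSine
        (Measurable.updateOpinion η (by fun_prop) (by fun_prop))).pow_const δ).ennreal_ofReal
    let G : UnitSphere d × UnitSphere d → ENNReal := fun z =>
      ENNReal.ofReal (sqSine (z.1 : E) (z.2 : E) ^ δ)
    have hG : Measurable G :=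
      ((Measurable.sqSine (by fun_prop) (by fun_prop)).pow_const δ).ennreal_ofReal
    -- Independence makes the joint law a product, so the one-step contraction applies with the
    -- current opinions frozen.
    have hind := (indepFun_iff_map_prod_eq_prod_map_map hX (hv t)).1
      (indepFun_sphereOpinion hη hv_indep hv x y t)
    rw [(hv_unif t).map_eq] at hind
    calc ∫⁻ ω, F (t + 1) ω ∂P = ∫⁻ ω, H (X ω, v t ω) ∂P := rfl
      _ = ∫⁻ z, H z ∂((P.map X).prod (uniformSphere d)) := by
        rw [← hind, lintegral_map' hH.aemeasurable (hX.prodMk (hv t))]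
      _ = ∫⁻ z, ∫⁻ w, H (z, w) ∂uniformSphere d ∂(P.map X) :=
        lintegral_prod _ hH.aemeasurable
      _ ≤ ∫⁻ z, ρ * G z ∂(P.map X) := lintegral_mono fun z => hcontr z.1 z.2
      _ = ρ * ∫⁻ z, G z ∂(P.map X) := lintegral_const_mul _ hG
      _ = ρ * ∫⁻ ω, F t ω ∂P := by rw [lintegral_map' hG.aemeasurable hX]; rfl
  have hgeom : ∀ t, ∫⁻ ω, F t ω ∂P ≤ ρ ^ t := by
    intro t
    induction t with
    | zero =>
      rw [pow_zero]
      refine (lintegral_mono (g := fun _ => 1) fun ω => ?_).trans (by simp)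
      refine ENNReal.ofReal_le_one.2 (Real.rpow_le_one (sqSine_nonneg ?_ ?_) sqSine_le_one hδ.le) <;>
        exact norm_opinion hη _ _ _
    | succ t ih =>
      rw [pow_succ']
      exact (hstep t).trans (by gcongr)
  have hsum : ∫⁻ ω, ∑' t, F t ω ∂P ≠ ⊤ := by
    rw [lintegral_tsum hF]
    refine ne_top_of_le_ne_top ?_ (ENNReal.tsum_le_tsum hgeom)
    rw [ENNReal.tsum_geometric]
    exact ENNReal.inv_ne_top.2 (tsub_pos_of_lt hρ).ne'
  filter_upwards [ae_lt_top' (AEMeasurable.tsum hF) hsum] with ω hω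
  have h1 := ENNReal.tendsto_atTop_zero_of_tsum_ne_top hω.ne
  have hnn : ∀ t, 0 ≤ sqSine (opinion η (fun s => v s ω) x t) (opinion η (fun s => v s ω) y t) :=
    fun t => sqSine_nonneg (norm_opinion hη _ _ _) (norm_opinion hη _ _ _)
  have h2 := (ENNReal.tendsto_toReal ENNReal.zero_ne_top).comp h1
  have h3 := h2.rpow_const (p := δ⁻¹) (Or.inr (by positivity))
  rw [ENNReal.toReal_zero, Real.zero_rpow (by positivity)] at h3
  refine h3.congr fun t => ?_
  simp only [Function.comp, F]
  rw [ENNReal.toReal_ofReal (Real.rpow_nonneg (hnn t) _), Real.rpow_rpow_inv (hnn t) hδ.ne']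

end Probability

/-! ### From alignment up to sign to merging or antipodality -/

section Deterministic

variable {d : ℕ} {η : ℝ} {v : ℕ → UnitSphere d}

lemma opinion_neg (x : UnitSphere d) (t : ℕ) : opinion η v (-x) t = -opinion η v x t := by
  induction t with
  | zero => simp [opinion]
  | succ t ih => rw [opinion, opinion, ih, updateOpinion_neg]

/-- If the angle between two opinions eventually is small or close to `π`, and the opinions lie in
the same half space at a late time, then they merge. -/
lemma tendsto_norm_sub_opinion (hη : 0 < η) {x y : UnitSphere d} {r : ℝ} (hr : r < 1)
    (hr' : (2 * η + η ^ 2) * (1 - r) < r)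
    (h : Tendsto (fun t => sqSine (opinion η v x t) (opinion η v y t)) atTop (𝓝 0)) {T : ℕ}
    (hT : ∀ t ≥ T, sqSine (opinion η v x t) (opinion η v y t) < 1 - r ^ 2)
    (hpos : 0 < inner ℝ (opinion η v x T) (opinion η v y T)) :
    Tendsto (fun t => ‖opinion η v x t - opinion η v y t‖) atTop (𝓝 0) := by
  have hκ : 0 < 2 * η + η ^ 2 := by positivity
  have hr0 : 0 < r := by nlinarith
  have hlow : ∀ t ≥ T, 0 < inner ℝ (opinion η v x t) (opinion η v y t) →
      r < inner ℝ (opinion η v x t) (opinion η v y t) := fun t ht h0 => by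
    have := hT t ht
    rw [sqSine] at this
    exact lt_of_pow_lt_pow_left₀ 2 h0.le (by linarith)
  have hall : ∀ t ≥ T, 0 < inner ℝ (opinion η v x t) (opinion η v y t) := by
    intro t ht
    induction t, ht using Nat.le_induction with
    | base => exact hpos
    | succ t ht ih =>
      refine inner_updateOpinion_pos hη (norm_opinion hη _ _ _) (norm_opinion hη _ _ _)
        (by simp) ?_
      nlinarith [hlow t ht ih]
  have hsq : Tendsto (fun t => ‖opinion η v x t - opinion η v y t‖ ^ 2) atTop (𝓝 0) := by
    have h2 := h.const_mul 2
    rw [mul_zero] at h2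
    -- For an inner product c in [0, 1], 2 - 2c ≤ 2(1 - c²).
    refine squeeze_zero' (Eventually.of_forall fun t => by positivity) ?_ h2
    filter_upwards [eventually_ge_atTop T] with t ht
    have h1 := hall t ht
    have h3 := sqSine_nonneg (norm_opinion hη v x t) (norm_opinion hη v y t)
    rw [norm_sub_sq_real, norm_opinion hη, norm_opinion hη]
    rw [sqSine] at h3 ⊢
    nlinarith
  have h4 := hsq.sqrt
  rw [Real.sqrt_zero] at h4
  exact h4.congr fun t => Real.sqrt_sq (norm_nonneg _)

/-- The dynamics is odd, so replacing y by -y reduces an obtuse angle at the late time T to an acute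
one. -/
lemma tendsto_norm_sub_or_add_opinion (hη : 0 < η) {x y : UnitSphere d}
    (h : Tendsto (fun t => sqSine (opinion η v x t) (opinion η v y t)) atTop (𝓝 0)) :
    Tendsto (fun t => ‖opinion η v x t - opinion η v y t‖) atTop (𝓝 0) ∨
      Tendsto (fun t => ‖opinion η v x t + opinion η v y t‖) atTop (𝓝 0) := by
  have hκ : 0 < 2 * η + η ^ 2 := by positivity
  set κ := 2 * η + η ^ 2
  -- The lower bound on r is a rewriting of κ(1 - r) < r, the condition that prevents a jump to the
  -- other half space.
  obtain ⟨r, hr, hr1⟩ : ∃ r, κ / (1 + κ) < r ∧ r < 1 :=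
    exists_between ((div_lt_one (by positivity)).2 (by linarith))
  have hr0 : 0 < r := lt_trans (by positivity) hr
  have hr' : κ * (1 - r) < r := by
    rw [div_lt_iff₀ (by positivity)] at hr
    linarith
  have hr2 : 0 < 1 - r ^ 2 := by nlinarith
  obtain ⟨T, hT⟩ := eventually_atTop.1 (h.eventually (gt_mem_nhds hr2))
  have hneg : ∀ t, sqSine (opinion η v x t) (opinion η v (-y) t) =
      sqSine (opinion η v x t) (opinion η v y t) := fun t => by
    rw [opinion_neg, sqSine, inner_neg_right, neg_sq, sqSine]
  rcases lt_trichotomy (inner ℝ (opinion η v x T) (opinion η v y T)) 0 with h0 | h0 | h0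
  · right
    have := tendsto_norm_sub_opinion hη (x := x) (y := -y) (v := v) hr1 hr'
      (h.congr fun t => (hneg t).symm) (T := T) (fun t ht => (hneg t).trans_lt (hT t ht))
      (by rw [opinion_neg, inner_neg_right]; linarith)
    refine this.congr fun t => ?_
    rw [opinion_neg, sub_neg_eq_add]
  · have := hT T le_rfl
    rw [sqSine, h0] at this
    nlinarith
  · left
    exact tendsto_norm_sub_opinion hη hr1 hr' h hT h0

end Deterministic

/-! ### The two clusters -/

lemma tendsto_diam_range_of_tendsto_norm_sub {E ι : Type*} [SeminormedAddCommGroup E] [Fintype ι]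
    {u : ι → ℕ → E} {p : ℕ → E} (h : ∀ i, Tendsto (fun t => ‖u i t - p t‖) atTop (𝓝 0)) :
    Tendsto (fun t => Metric.diam (Set.range fun i => u i t)) atTop (𝓝 0) := by
  have h1 : Tendsto (fun t => 2 * ∑ i, ‖u i t - p t‖) atTop (𝓝 0) := by
    simpa using (tendsto_finsetSum Finset.univ fun i _ => h i).const_mul 2
  refine squeeze_zero (fun t => Metric.diam_nonneg) (fun t => ?_) h1
  refine Metric.diam_le_of_forall_dist_le (by positivity) ?_
  rintro _ ⟨i, rfl⟩ _ ⟨j, rfl⟩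
  have hle : ∀ i, ‖u i t - p t‖ ≤ ∑ i, ‖u i t - p t‖ := fun i =>
    Finset.single_le_sum (f := fun i => ‖u i t - p t‖) (fun _ _ => norm_nonneg _)
      (Finset.mem_univ i)
  have := dist_triangle_right (u i t) (u j t) (p t)
  rw [dist_eq_norm (u i t) (p t), dist_eq_norm (u j t) (p t)] at this
  linarith [hle i, hle j]

theorem mainTheorem2 {Ω : Type*} [MeasurableSpace Ω] (P : Measure Ω) [IsProbabilityMeasure P]
    (d : ℕ) (hd : 2 ≤ d) (η : ℝ) (hη : 0 < η) (n : ℕ) (u₀ : Fin n → UnitSphere d)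
    (v : ℕ → Ω → UnitSphere d)
    (hv_indep : iIndepFun v P) (hv_unif : ∀ t, HasLaw (v t) (uniformSphere d) P) :
    ∀ᵐ ω ∂P, ∃ J : Finset (Fin n),
      Tendsto
        (fun t : ℕ => Metric.diam
          (Set.range fun i : Fin n => flipSign J i • opinion η (fun s => v s ω) (u₀ i) t))
        atTop (𝓝 0) ∧
      ∃ p : ℕ → UnitSphere d, ∀ i : Fin n,
        Tendsto
          (fun t : ℕ => ‖opinion η (fun s => v s ω) (u₀ i) t -
            flipSign J i • (p t : EuclideanSpace ℝ (Fin d))‖)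
          atTop (𝓝 0) := by
  classical
  -- An auxiliary agent, not necessarily one of the n, serves as reference; its trajectory is p, and
  -- n = 0 needs no separate case.
  obtain ⟨x₀⟩ : Nonempty (UnitSphere d) :=
    ⟨⟨EuclideanSpace.single ⟨0, by omega⟩ 1, by simp⟩⟩
  filter_upwards [ae_all_iff.2 fun i => ae_tendsto_sqSine_opinion hd hη hv_indep hv_unif (u₀ i) x₀]
    with ω hω
  set w : ℕ → UnitSphere d := fun s => v s ω
  set J : Finset (Fin n) := Finset.univ.filter fun i =>
    ¬ Tendsto (fun t => ‖opinion η w (u₀ i) t - opinion η w x₀ t‖) atTop (𝓝 0)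
  have hlim : ∀ i, Tendsto (fun t => ‖opinion η w (u₀ i) t -
      flipSign J i • opinion η w x₀ t‖) atTop (𝓝 0) := by
    intro i
    by_cases hi : Tendsto (fun t => ‖opinion η w (u₀ i) t - opinion η w x₀ t‖) atTop (𝓝 0)
    · simp [flipSign, J, hi]
    · simpa [flipSign, J, hi] using (tendsto_norm_sub_or_add_opinion hη (hω i)).resolve_left hi
  refine ⟨J, tendsto_diam_range_of_tendsto_norm_sub (p := opinion η w x₀) fun i => ?_,
    fun t => sphereOpinion hη x₀ t w, hlim⟩
  refine (hlim i).congr fun t => ?_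
  unfold flipSign
  split_ifs
  · rw [pow_one, neg_one_smul, neg_one_smul, ← norm_neg]
    congr 1
    abel
  · simp
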